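/- Let $n\ge 3$ and let $L=L_n(2)=\mathrm{PSL}_n(2)$ be the projective special linear group of degree $n$ over the field with two elements. For a positive integer $m$ let $\pi(m)$ be the set of prime divisors of $m$, and put $\pi(L)=\pi(|L|)$. The Gruenberg–Kegel graph (prime graph) of $L$ has vertex set $\pi(L)$, two distinct primes $p,q\in\pi(L)$ being adjacent if and only if $L$ contains an element of order $pq$. Let $\deg_L(p)$ be the degree of the vertex $p$, and let $t(p,L)$ be the maximal number of vertices in an independent set of this graph containing $p$. For $k\ge 1$ let $\mathrm{ppd}(2^k-1)$ be the set of primitive prime divisors of $2^k-1$, that is, of primes $p$ with $p\mid 2^k-1$ and $p\nmid 2^m-1$ for all $1\le m<k$. Then the following hold. (a) $2\in\pi(L)$, and $$\deg_L(2)=|\pi(L)|-\bigl|\mathrm{ppd}(2^{n-1}-1)\cup\mathrm{ppd}(2^n-1)\bigr|-1 .$$ In particular, $t(2,L)\ge 2$. Moreover, every odd prime $r\in\pi(L)$ belongs to $\mathrm{ppd}(2^k-1)$ for some $k$ with $2\le k\le n$, so that (a), (b) and (c) determine the degrees of all vertices. Let $r\in\pi(L)$ be an odd prime with $r\in\mathrm{ppd}(2^k-1)$,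 $k\ge1$. (b) If $k=n$ or $k=n-1$, then $\deg_L(r)=|\pi(2^k-1)|-1$. (c) If $k\ne n$ and $k\neq n-1$, then $$\deg_L(r)=\begin{cases}\Bigl|\bigcup\limits_{i=2}^{n-k}\mathrm{ppd}(2^i-1)\Bigr|+\bigl|\mathrm{ppd}(2^{\lfloor n/k\rfloor k}-1)\bigr| & \text{if } k\le n/2,\\[2mm] \Bigl|\pi(2^k-1)\cup\bigcup\limits_{i=2}^{n-k}\mathrm{ppd}(2^i-1)\Bigr| & \text{if } k>n/2.\end{cases}$$ -/

import Mathlib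

/-- The set `π(G)` of prime divisors of the order of a finite group `G`. -/
noncomputable def primeSet (G : Type*) [Group G] [Finite G] : Finset ℕ :=
  (Nat.card G).primeFactors

/-- The Gruenberg-Kegel graph (prime graph) of a finite group `G`: its vertices are the primes
dividing `|G|`, and two distinct vertices `p`, `q` are adjacent iff `G` has an element
of order `p * q`. -/
def gkGraph (G : Type*) [Group G] [Finite G] : SimpleGraph (primeSet G) where
  Adj p q := p ≠ q ∧ ∃ g : G, orderOf g = (p : ℕ) * (q : ℕ)
  symm := ⟨fun _ _ h => ⟨h.1.symm, h.2.imp fun _ hg => hg.trans (Nat.mul_comm _ _)⟩⟩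
  loopless := ⟨fun _ h => h.1 rfl⟩

open Classical in
/-- The degree `deg_G(p)` of the vertex `p` in the Gruenberg-Kegel graph of `G`. -/
noncomputable def gkDegree (G : Type*) [Group G] [Finite G] (p : primeSet G) : ℕ :=
  (gkGraph G).degree p

/-- The number `t(r, G)`: the maximal number of vertices in an independent set of the
Gruenberg-Kegel graph of `G` containing the vertex `r`. -/
noncomputable def gkIndepNumAt (G : Type*) [Group G] [Finite G] (r : primeSet G) : ℕ :=
  sSup {m : ℕ | ∃ s : Finset (primeSet G), r ∈ s ∧ (gkGraph G).IsNIndepSet m s}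

/-- The set `ppd(a ^ n - 1)` of primitive prime divisors of `a ^ n - 1` (for `a ≥ 2`, `n ≥ 1`):
primes dividing `a ^ n - 1` but no `a ^ m - 1` with `1 ≤ m < n`. For `n = 0` it is empty. -/
def ppd (a n : ℕ) : Finset ℕ :=
  (a ^ n - 1).primeFactors.filter fun p => ∀ m ∈ Finset.Ico 1 n, ¬ p ∣ a ^ m - 1

/-- The projective special linear group `L_n(2) = PSL_n(2)` over the field with two elements. -/
abbrev projSL2 (n : ℕ) : Type :=
  Matrix.ProjectiveSpecialLinearGroup (Fin n) (ZMod 2)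

/-! ### Commuting operators of prime order over the field with two elements. -/

section FixedPointFree

open Module

variable {V : Type*} [AddCommGroup V] [Module (ZMod 2) V]

/-! Over the field with two elements every invertible matrix has determinant 1 and the only nonzero
scalar is 1, so adjacency of `p` and `q` means that a matrix of order `p * q` exists. An odd prime
`r` has index `k`, the order of 2 mod `r`; adjacency depends only on indices.

If `x ^ r = 1`, then `x` fixes no nonzero vector of the range of `x - 1`, and counting vectors mod
`r` shows that `k` divides its dimension. Let a commuting `y` of odd prime order have index `l`.
Either one operator moves a vector fixed by the other, and `k + l ≤ n`, or both have the same fixed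
space and `lcm k l` divides the rank of `x - 1`; this again gives `k + l ≤ n` unless one index
divides the other (`orderOf_two_add_le_or_dvd`). For an involution the condition is `k + 2 ≤ n`
(`orderOf_two_add_two_le`). Multiplication in finite fields and block sums give the converses.

The degrees then count primes by index, the sets `ppd 2 l` being disjoint. The bound on independent
sets needs a primitive prime of index `n` or `n - 1`: one of these is odd, and Zsigmondy's theorem
for odd exponents applies. -/

theorem zmod_two_odd_smul {r : ℕ} (hr : Odd r) (v : V) : r • v = v := by
  obtain ⟨m, rfl⟩ := hr
  have h2 : (2 : ℕ) • v = 0 := by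
    rw [← Nat.cast_smul_eq_nsmul (ZMod 2)]
    have : ((2 : ℕ) : ZMod 2) = 0 := by decide
    rw [this, zero_smul]
  rw [add_smul, one_smul, mul_comm, mul_smul, h2, smul_zero, zero_add]

/-- The sum of `f ^ i` for `i < r` kills the range of `f - 1`, but multiplies a fixed vector by `r`,
which is 1 in characteristic 2. -/
theorem eq_zero_of_fixed_of_mem_range {r : ℕ} (hr : Odd r) {f : End (ZMod 2) V} (hf : f ^ r = 1)
    {v : V} (hv : f v = v) (hm : v ∈ LinearMap.range (f - 1)) : v = 0 := by
  obtain ⟨u, hu⟩ := hm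
  have hpow : ∀ i : ℕ, (f ^ i) v = v := by
    intro i
    induction i with
    | zero => rfl
    | succ i ih => rw [pow_succ, Module.End.mul_apply, hv, ih]
  have h1 : (∑ i ∈ Finset.range r, f ^ i) v = v := by
    rw [LinearMap.sum_apply, Finset.sum_congr rfl fun i _ => hpow i, Finset.sum_const,
      Finset.card_range, zmod_two_odd_smul hr]
  rw [← h1, ← hu, ← Module.End.mul_apply, geom_sum_mul, hf, sub_self, LinearMap.zero_apply]

theorem exists_apply_ne {f : End (ZMod 2) V} (hf : f ≠ 1) : ∃ v, f v ≠ v := by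
  by_contra! h
  exact hf (LinearMap.ext h)

theorem apply_mem_range_of_commute {x y : End (ZMod 2) V} (h : Commute x y) {w : V}
    (hw : w ∈ LinearMap.range (x - 1)) : y w ∈ LinearMap.range (x - 1) := by
  obtain ⟨u, rfl⟩ := hw
  have hc : Commute y (x - 1) := h.symm.sub_right (Commute.one_right y)
  exact ⟨y u, by rw [← Module.End.mul_apply, ← Module.End.mul_apply, hc.eq]⟩

theorem apply_mem_ker_of_commute {x y : End (ZMod 2) V} (h : Commute x y) {w : V}
    (hw : w ∈ LinearMap.ker (x - 1)) : y w ∈ LinearMap.ker (x - 1) := by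
  have hc : Commute (x - 1) y := h.sub_left (Commute.one_left y)
  rw [LinearMap.mem_ker] at hw ⊢
  rw [← Module.End.mul_apply, hc.eq, Module.End.mul_apply, hw, map_zero]

theorem mem_ker_sub_one {x : End (ZMod 2) V} {w : V} : w ∈ LinearMap.ker (x - 1) ↔ x w = w := by
  rw [LinearMap.mem_ker, LinearMap.sub_apply, sub_eq_zero, Module.End.one_apply]

variable [FiniteDimensional (ZMod 2) V]

/-- If an endomorphism of odd prime order `r` acts without fixed points on an invariant subspace
over `𝔽₂`, then the order of `2` modulo `r` divides the dimension of the subspace. -/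
theorem orderOf_two_dvd_finrank {r : ℕ} (hr : r.Prime) {f : End (ZMod 2) V} (hf : f ^ r = 1)
    {W : Submodule (ZMod 2) V} (hW : ∀ w ∈ W, f w ∈ W) (h0 : ∀ w ∈ W, f w = w → w = 0) :
    orderOf (2 : ZMod r) ∣ finrank (ZMod 2) W := by
  classical
  have := Fact.mk hr
  have : Finite V := Module.finite_of_finite (ZMod 2)
  have := Fintype.ofFinite W
  let φ : Function.End W := fun w => ⟨f w, hW w w.2⟩
  have hiter : ∀ (m : ℕ) (w : W), (((φ ^ m : Function.End W) w : W) : V) = (f ^ m) (w : V) := by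
    intro m
    induction m with
    | zero => intro w; rfl
    | succ m ih =>
      intro w
      rw [pow_succ, pow_succ, Module.End.mul_apply]
      exact ih (φ w)
  have hφ : φ ^ r ^ 1 = 1 := by
    funext w
    apply Subtype.ext
    rw [hiter, pow_one, hf]
    rfl
  -- Orbits have size 1 or `r` and only 0 is fixed, so `2 ^ dim W` is 1 mod `r`.
  have hmod := Equiv.Perm.card_fixedPoints_modEq hφ
  have hfix : Function.fixedPoints φ = {0} := by
    ext w
    rw [Set.mem_singleton_iff]
    constructor
    · intro h
      exact Subtype.ext (h0 w w.2 (congrArg Subtype.val h))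
    · rintro rfl
      exact Subtype.ext (map_zero f)
  have hcard : Fintype.card (Function.fixedPoints φ) = 1 := by
    rw [Fintype.card_eq_one_iff]
    refine ⟨⟨0, by rw [hfix]; rfl⟩, fun y => Subtype.ext ?_⟩
    exact hfix.subset y.2
  rw [hcard, Module.card_eq_pow_finrank (K := ZMod 2), ZMod.card] at hmod
  rw [orderOf_dvd_iff_pow_eq_one]
  have := (ZMod.natCast_eq_natCast_iff _ _ _).2 hmod
  simpa using this

theorem finrank_pos_of_mem {W : Submodule (ZMod 2) V} {v : V} (hv : v ∈ W) (h : v ≠ 0) :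
    0 < finrank (ZMod 2) W := by
  rw [Module.finrank_pos_iff_exists_ne_zero]
  exact ⟨⟨v, hv⟩, fun h' => h (congrArg Subtype.val h')⟩

/-- A nontrivial action of an element of odd prime order `r` needs dimension at least the order of
`2` modulo `r`. -/
theorem orderOf_two_le_finrank {r : ℕ} (hr : r.Prime) (ho : Odd r) {f : End (ZMod 2) V}
    (hf : f ^ r = 1) {U : Submodule (ZMod 2) V} (hU : ∀ u ∈ U, f u ∈ U) {u : V} (hu : u ∈ U)
    (hne : f u ≠ u) : orderOf (2 : ZMod r) ≤ finrank (ZMod 2) U := by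
  -- The image of `U` under `f - 1` is the part of `U` without fixed vectors; it is nonzero because
  -- `u` moves.
  have hle : U.map (f - 1) ≤ U := by
    rintro _ ⟨v, hv, rfl⟩
    exact U.sub_mem (hU v hv) hv
  have hd : orderOf (2 : ZMod r) ∣ finrank (ZMod 2) (U.map (f - 1)) := by
    refine orderOf_two_dvd_finrank hr hf ?_ ?_
    · rintro w hw
      have := U.map (f - 1) |>.add_mem (Submodule.mem_map_of_mem (f := f - 1) (hle hw)) hw
      simpa using this
    · intro w hw hfw
      exact eq_zero_of_fixed_of_mem_range ho hf hfw (LinearMap.map_le_range hw)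
  have hpos : 0 < finrank (ZMod 2) (U.map (f - 1)) :=
    finrank_pos_of_mem (Submodule.mem_map_of_mem (f := f - 1) hu) (sub_ne_zero.2 hne)
  exact (Nat.le_of_dvd hpos hd).trans (Submodule.finrank_mono hle)

theorem orderOf_two_dvd_finrank_range {r : ℕ} (hr : r.Prime) (ho : Odd r) {x : End (ZMod 2) V}
    (hx : x ^ r = 1) : orderOf (2 : ZMod r) ∣ finrank (ZMod 2) (LinearMap.range (x - 1)) :=
  orderOf_two_dvd_finrank hr hx (fun _ hw => apply_mem_range_of_commute (Commute.refl x) hw)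
    fun _ hw h => eq_zero_of_fixed_of_mem_range ho hx h hw

theorem finrank_range_sub_one_pos {x : End (ZMod 2) V} (hx : x ≠ 1) :
    0 < finrank (ZMod 2) (LinearMap.range (x - 1)) := by
  obtain ⟨v, hv⟩ := exists_apply_ne hx
  exact finrank_pos_of_mem (LinearMap.mem_range_self (x - 1) v) (sub_ne_zero.2 hv)

/-- If `y` moves a vector fixed by `x`, the kernel of `x - 1` has dimension at least the index of
`s` and the range at least that of `r`; rank-nullity adds them. -/
theorem orderOf_two_add_le_or_ker_le {r s : ℕ} (hr : r.Prime) (hor : Odd r) (hs : s.Prime)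
    (hos : Odd s) {x y : End (ZMod 2) V} (h : Commute x y) (hx : x ^ r = 1) (hy : y ^ s = 1)
    (hx1 : x ≠ 1) :
    orderOf (2 : ZMod r) + orderOf (2 : ZMod s) ≤ finrank (ZMod 2) V ∨
      LinearMap.ker (x - 1) ≤ LinearMap.ker (y - 1) := by
  by_cases hle : LinearMap.ker (x - 1) ≤ LinearMap.ker (y - 1)
  · exact Or.inr hle
  · left
    obtain ⟨u, hu, hu'⟩ := SetLike.not_le_iff_exists.1 hle
    rw [mem_ker_sub_one] at hu'
    have h1 := orderOf_two_le_finrank hs hos hy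
      (fun u hu => apply_mem_ker_of_commute h hu) hu hu'
    have h2 := Nat.le_of_dvd (finrank_range_sub_one_pos hx1)
      (orderOf_two_dvd_finrank_range hr hor hx)
    have h3 := LinearMap.finrank_range_add_finrank_ker (x - 1)
    omega

theorem orderOf_two_add_le_or_dvd {r s : ℕ} (hr : r.Prime) (hor : Odd r) (hs : s.Prime)
    (hos : Odd s) {x y : End (ZMod 2) V} (h : Commute x y) (hx : x ^ r = 1) (hy : y ^ s = 1)
    (hx1 : x ≠ 1) (hy1 : y ≠ 1) :
    orderOf (2 : ZMod r) + orderOf (2 : ZMod s) ≤ finrank (ZMod 2) V ∨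
      orderOf (2 : ZMod r) ∣ orderOf (2 : ZMod s) ∨ orderOf (2 : ZMod s) ∣ orderOf (2 : ZMod r) := by
  rcases orderOf_two_add_le_or_ker_le hr hor hs hos h hx hy hx1 with h1 | h1
  · exact Or.inl h1
  rcases orderOf_two_add_le_or_ker_le hs hos hr hor h.symm hy hx hy1 with h2 | h2
  · left; omega
  have hk := orderOf_two_dvd_finrank_range hr hor hx
  have hl : orderOf (2 : ZMod s) ∣ finrank (ZMod 2) (LinearMap.range (x - 1)) := by
    refine orderOf_two_dvd_finrank hs hy (fun _ hw => apply_mem_range_of_commute h hw) ?_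
    intro w hw hyw
    exact eq_zero_of_fixed_of_mem_range hor hx
      (mem_ker_sub_one.1 (h2 (mem_ker_sub_one.2 hyw))) hw
  have hpos := finrank_range_sub_one_pos hx1
  have hle := Submodule.finrank_le (LinearMap.range (x - 1))
  have hlcm := Nat.le_of_dvd hpos (Nat.lcm_dvd hk hl)
  by_contra! hcon
  obtain ⟨hlt, hn1, hn2⟩ := hcon
  generalize orderOf (2 : ZMod r) = k at *
  generalize orderOf (2 : ZMod s) = l at *
  -- With neither index dividing the other, the lcm is at least twice each, hence at least `k + l`.
  obtain ⟨a, ha⟩ := Nat.dvd_lcm_left k l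
  obtain ⟨b, hb⟩ := Nat.dvd_lcm_right k l
  have hlcm0 : 0 < Nat.lcm k l := Nat.pos_of_dvd_of_pos (Nat.lcm_dvd hk hl) hpos
  have ha2 : 2 ≤ a := by
    rcases a with _ | _ | a
    · omega
    · exact absurd (Dvd.intro_left b (by rw [mul_comm, ← hb, ha]; ring)) hn2
    · omega
  have hb2 : 2 ≤ b := by
    rcases b with _ | _ | b
    · omega
    · exact absurd (Dvd.intro_left a (by rw [mul_comm, ← ha, hb]; ring)) hn1
    · omega
  have h3 : k * 2 ≤ Nat.lcm k l := ha ▸ Nat.mul_le_mul_left k ha2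
  have h4 : l * 2 ≤ Nat.lcm k l := hb ▸ Nat.mul_le_mul_left l hb2
  omega

/-- In characteristic 2, `(y - 1) ^ 2 = 0`, so `y - 1` cannot map `U` onto itself unless `y` is
trivial there. -/
theorem finrank_map_sub_one_of_involution {y : End (ZMod 2) V} (hy : y ^ 2 = 1)
    {U : Submodule (ZMod 2) V} (hU : ∀ u ∈ U, y u ∈ U) {u : V} (hu : u ∈ U) (hne : y u ≠ u) :
    0 < finrank (ZMod 2) (U.map (y - 1)) ∧
      finrank (ZMod 2) (U.map (y - 1)) < finrank (ZMod 2) U := by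
  refine ⟨finrank_pos_of_mem (Submodule.mem_map_of_mem (f := y - 1) hu) (sub_ne_zero.2 hne), ?_⟩
  apply Submodule.finrank_lt_finrank_of_lt
  refine lt_of_le_of_ne ?_ ?_
  · rintro _ ⟨v, hv, rfl⟩
    exact U.sub_mem (hU v hv) hv
  · intro heq
    have hu2 := hu
    rw [← heq] at hu2
    obtain ⟨v, -, rfl⟩ := hu2
    apply hne
    rw [← sub_eq_zero]
    have h2 : y * (y - 1) - (y - 1) = 0 := by
      have h3 : y * (y - 1) - (y - 1) = (y ^ 2 - 1) - (2 : ℕ) • (y - 1) := by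
        rw [two_smul]; noncomm_ring
      rw [h3, hy, sub_self, zero_sub, neg_eq_zero]
      ext v
      rw [← Nat.cast_smul_eq_nsmul (ZMod 2)]
      have : ((2 : ℕ) : ZMod 2) = 0 := by decide
      rw [this, zero_smul]
    exact congrArg (fun g : End (ZMod 2) V => g v) h2

/-- If `y` moves a vector fixed by `x`, the fixed space has dimension at least 2. Otherwise `y` acts
nontrivially on the range `W` of `x - 1`, and `(y - 1) W` is a nonzero proper `x`-invariant subspace
whose dimension is also a multiple of the index; so `dim W` is at least twice the index. -/
theorem orderOf_two_add_two_le {r : ℕ} (hr : r.Prime) (hor : Odd r)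
    {x y : End (ZMod 2) V} (h : Commute x y) (hx : x ^ r = 1) (hy : y ^ 2 = 1)
    (hx1 : x ≠ 1) (hy1 : y ≠ 1) (hk2 : 2 ≤ orderOf (2 : ZMod r)) :
    orderOf (2 : ZMod r) + 2 ≤ finrank (ZMod 2) V := by
  have hW := orderOf_two_dvd_finrank_range hr hor hx
  have hWpos := finrank_range_sub_one_pos hx1
  have hsum := LinearMap.finrank_range_add_finrank_ker (x - 1)
  by_cases hle : LinearMap.ker (x - 1) ≤ LinearMap.ker (y - 1)
  · have hex : ∃ w ∈ LinearMap.range (x - 1), y w ≠ w := by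
      by_contra! hcon
      obtain ⟨v, hv⟩ := exists_apply_ne hy1
      apply hv
      have htop : LinearMap.ker (x - 1) ⊔ LinearMap.range (x - 1) = ⊤ := by
        apply Submodule.eq_top_of_disjoint
        · omega
        · rw [Submodule.disjoint_def]
          intro w h1 h2
          exact eq_zero_of_fixed_of_mem_range hor hx (mem_ker_sub_one.1 h1) h2
      have : v ∈ LinearMap.ker (x - 1) ⊔ LinearMap.range (x - 1) := htop ▸ Submodule.mem_top
      obtain ⟨a, ha, b, hb, rfl⟩ := Submodule.mem_sup.1 this
      rw [map_add, hcon b hb, mem_ker_sub_one.1 (hle ha)]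
    obtain ⟨w, hw, hyw⟩ := hex
    obtain ⟨h1, h2⟩ := finrank_map_sub_one_of_involution hy
      (fun _ hw => apply_mem_range_of_commute h hw) hw hyw
    have hd : orderOf (2 : ZMod r) ∣
        finrank (ZMod 2) ((LinearMap.range (x - 1)).map (y - 1)) := by
      refine orderOf_two_dvd_finrank hr hx ?_ ?_
      · rintro _ ⟨v, hv, rfl⟩
        refine ⟨x v, apply_mem_range_of_commute (Commute.refl x) hv, ?_⟩
        have hc : Commute (y - 1) x := h.symm.sub_left (Commute.one_left x)
        rw [← Module.End.mul_apply, hc.eq, Module.End.mul_apply]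
      · rintro _ ⟨v, hv, rfl⟩ hfix
        refine eq_zero_of_fixed_of_mem_range hor hx hfix ?_
        exact Submodule.sub_mem _ (apply_mem_range_of_commute h hv) hv
    obtain ⟨a, ha⟩ := hW
    obtain ⟨b, hb⟩ := hd
    rw [hb] at h1 h2
    rw [ha] at h2 hsum
    have hb1 : 0 < b := Nat.pos_of_mul_pos_left h1
    have hab : b < a := lt_of_mul_lt_mul_left h2 (Nat.zero_le _)
    have : orderOf (2 : ZMod r) * 2 ≤ orderOf (2 : ZMod r) * a :=
      Nat.mul_le_mul_left _ (by omega)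
    omega
  · obtain ⟨u, hu, hu'⟩ := SetLike.not_le_iff_exists.1 hle
    rw [mem_ker_sub_one] at hu'
    obtain ⟨h1, h2⟩ := finrank_map_sub_one_of_involution hy
      (fun u hu => apply_mem_ker_of_commute h hu) hu hu'
    have := Nat.le_of_dvd hWpos hW
    omega

end FixedPointFree

/-- `GL_n(2)` contains an element of order `m` (for `m > 0`), in terms of matrices. -/
def HasMatrixOrder (n m : ℕ) : Prop :=
  ∃ A : Matrix (Fin n) (Fin n) (ZMod 2), orderOf A = m

/-! ### Constructing matrices of given order. -/

section ElementOrders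

open Module

theorem hasMatrixOrder_iff {n m : ℕ} (V : Type*) [AddCommGroup V] [Module (ZMod 2) V]
    [FiniteDimensional (ZMod 2) V] (hV : finrank (ZMod 2) V = n) :
    HasMatrixOrder n m ↔ ∃ f : End (ZMod 2) V, orderOf f = m := by
  let e := (LinearMap.toMatrixAlgEquiv (finBasisOfFinrankEq (ZMod 2) V hV)).toMulEquiv
  constructor
  · rintro ⟨A, hA⟩
    exact ⟨e.symm A, (e.symm.orderOf_eq A).trans hA⟩
  · rintro ⟨f, hf⟩
    exact ⟨e f, (e.orderOf_eq f).trans hf⟩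

theorem HasMatrixOrder.add {a b x y : ℕ} (ha : HasMatrixOrder a x) (hb : HasMatrixOrder b y) :
    HasMatrixOrder (a + b) (Nat.lcm x y) := by
  obtain ⟨f, hf⟩ := (hasMatrixOrder_iff (Fin a → ZMod 2) (by simp)).1 ha
  obtain ⟨g, hg⟩ := (hasMatrixOrder_iff (Fin b → ZMod 2) (by simp)).1 hb
  rw [hasMatrixOrder_iff ((Fin a → ZMod 2) × (Fin b → ZMod 2)) (by simp)]
  refine ⟨LinearMap.prodMapRingHom (ZMod 2) (Fin a → ZMod 2) (Fin b → ZMod 2) (f, g), ?_⟩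
  have hinj : Function.Injective
      (LinearMap.prodMapRingHom (ZMod 2) (Fin a → ZMod 2) (Fin b → ZMod 2)) := by
    rintro ⟨f₁, g₁⟩ ⟨f₂, g₂⟩ h
    have h' := fun v => congrArg
      (fun k : End (ZMod 2) ((Fin a → ZMod 2) × (Fin b → ZMod 2)) => k v) h
    refine Prod.ext (LinearMap.ext fun u => ?_) (LinearMap.ext fun u => ?_)
    · exact congrArg Prod.fst (h' (u, 0))
    · exact congrArg Prod.snd (h' (0, u))
  have h := orderOf_injective
    (LinearMap.prodMapRingHom (ZMod 2) (Fin a → ZMod 2) (Fin b → ZMod 2)).toMonoidHom hinj (f, g)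
  rw [Prod.orderOf, hf, hg] at h
  exact h

theorem HasMatrixOrder.mono {a b x : ℕ} (h : HasMatrixOrder a x) (hab : a ≤ b) :
    HasMatrixOrder b x := by
  obtain ⟨c, rfl⟩ := Nat.exists_eq_add_of_le hab
  have h1 : HasMatrixOrder c 1 := ⟨1, orderOf_one⟩
  simpa using h.add h1

/-- Multiplication by elements of `𝔽_{2^l}` realizes every divisor of `2 ^ l - 1`. -/
theorem hasMatrixOrder_of_dvd {l d : ℕ} (hl : l ≠ 0) (hd : d ∣ 2 ^ l - 1) :
    HasMatrixOrder l d := by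
  classical
  have : Finite (GaloisField 2 l) := Module.finite_of_finite (ZMod 2)
  have := Fintype.ofFinite (GaloisField 2 l)
  rw [hasMatrixOrder_iff (GaloisField 2 l) (GaloisField.finrank 2 hl)]
  -- A generator of the multiplicative group (Singer cycle); its power with exponent `(2 ^ l - 1) /
  -- d` has order `d`.
  obtain ⟨u, hu⟩ := IsCyclic.exists_ofOrder_eq_natCard (α := (GaloisField 2 l)ˣ)
  have hcard : Nat.card (GaloisField 2 l)ˣ = 2 ^ l - 1 := by
    rw [Nat.card_units, GaloisField.card 2 l hl]
  rw [hcard] at hu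
  have hpos : 0 < 2 ^ l - 1 := by
    have := Nat.pow_le_pow_right (n := 2) two_pos (Nat.one_le_iff_ne_zero.2 hl)
    omega
  obtain ⟨e, he⟩ := hd
  have he0 : e ≠ 0 := by rintro rfl; omega
  have hue : orderOf (u ^ e) = d := by
    rw [orderOf_pow_of_dvd he0 (hu ▸ he ▸ Dvd.intro_left d rfl), hu, he]
    exact Nat.mul_div_cancel _ (Nat.pos_of_ne_zero he0)
  refine ⟨Algebra.lmul (ZMod 2) (GaloisField 2 l) ((u ^ e : (GaloisField 2 l)ˣ) : GaloisField 2 l),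
    ?_⟩
  have := orderOf_injective
    ((Algebra.lmul (ZMod 2) (GaloisField 2 l) : _ →* End (ZMod 2) (GaloisField 2 l)))
    (Algebra.lmul_injective) ((u ^ e : (GaloisField 2 l)ˣ) : GaloisField 2 l)
  rw [orderOf_units, hue] at this
  exact this

theorem hasMatrixOrder_two_two : HasMatrixOrder 2 2 := by
  refine ⟨!![0, 1; 1, 0], orderOf_eq_prime ?_ ?_⟩
  · decide
  · decide

theorem HasMatrixOrder.exists_commute {n p q : ℕ} (hp : p.Prime) (hq : q.Prime)
    (h : HasMatrixOrder n (p * q)) : ∃ x y : End (ZMod 2) (Fin n → ZMod 2),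
      Commute x y ∧ x ^ p = 1 ∧ y ^ q = 1 ∧ x ≠ 1 ∧ y ≠ 1 := by
  obtain ⟨f, hf⟩ := (hasMatrixOrder_iff (Fin n → ZMod 2) (by simp)).1 h
  refine ⟨f ^ q, f ^ p, (Commute.refl f).pow_pow q p, ?_, ?_, ?_, ?_⟩
  · rw [← pow_mul, mul_comm, ← hf, pow_orderOf_eq_one]
  · rw [← pow_mul, ← hf, pow_orderOf_eq_one]
  · intro h1
    have := Nat.le_of_dvd hq.pos (hf ▸ orderOf_dvd_of_pow_eq_one h1)
    nlinarith [hp.two_le, hq.pos]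
  · intro h1
    have := Nat.le_of_dvd hp.pos (hf ▸ orderOf_dvd_of_pow_eq_one h1)
    nlinarith [hq.two_le, hp.pos]

end ElementOrders

/-! ### Primitive prime divisors as orders of 2, and the adjacency criteria. -/

section PrimitiveDivisors

theorem mem_ppd_two {p k : ℕ} :
    p ∈ ppd 2 k ↔ p.Prime ∧ Odd p ∧ 2 ≤ k ∧ orderOf (2 : ZMod p) = k := by
  have key : ∀ (m : ℕ), p ∣ 2 ^ m - 1 ↔ orderOf (2 : ZMod p) ∣ m := by
    intro m
    rw [orderOf_dvd_iff_pow_eq_one, ← ZMod.natCast_eq_zero_iff, Nat.cast_sub Nat.one_le_two_pow,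
      sub_eq_zero]
    simp
  simp only [ppd, Finset.mem_filter, Nat.mem_primeFactors, Finset.mem_Ico, key]
  constructor
  · rintro ⟨⟨hp, hd, h0⟩, hmin⟩
    have hk0 : k ≠ 0 := by rintro rfl; simp at h0
    have hk1 : k ≠ 1 := by
      rintro rfl
      have := (key 1).2 hd
      simp at this
      exact hp.one_lt.ne' this
    refine ⟨hp, ?_, by omega, ?_⟩
    · rcases hp.eq_two_or_odd' with rfl | h
      · have h2 := (key k).2 hd
        have : 2 ∣ 2 ^ k := dvd_pow_self 2 hk0
        have := Nat.one_le_two_pow (n := k)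
        omega
      · exact h
    · have hpos : 0 < orderOf (2 : ZMod p) := Nat.pos_of_dvd_of_pos hd (Nat.pos_of_ne_zero hk0)
      have hle := Nat.le_of_dvd (Nat.pos_of_ne_zero hk0) hd
      by_contra hne
      exact hmin _ ⟨hpos, lt_of_le_of_ne hle hne⟩ dvd_rfl
  · rintro ⟨hp, -, hk, rfl⟩
    refine ⟨⟨hp, dvd_rfl, ?_⟩, fun m hm h => ?_⟩
    · have := Nat.pow_le_pow_right (n := 2) two_pos hk
      omega
    · exact absurd (Nat.le_of_dvd (by omega) h) (by omega)

theorem prime_dvd_two_pow_sub_one_iff {p k l : ℕ} (hp : p ∈ ppd 2 k) :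
    p ∣ 2 ^ l - 1 ↔ k ∣ l := by
  rw [← (mem_ppd_two.1 hp).2.2.2, orderOf_dvd_iff_pow_eq_one, ← ZMod.natCast_eq_zero_iff,
    Nat.cast_sub Nat.one_le_two_pow, sub_eq_zero]
  simp

theorem ppd_two_index_unique {p k l : ℕ} (hk : p ∈ ppd 2 k) (hl : p ∈ ppd 2 l) : k = l :=
  (mem_ppd_two.1 hk).2.2.2.symm.trans (mem_ppd_two.1 hl).2.2.2

theorem exists_mem_ppd_two {p : ℕ} (hp : p.Prime) (ho : Odd p) : ∃ k, p ∈ ppd 2 k := by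
  have := Fact.mk hp
  refine ⟨orderOf (2 : ZMod p), mem_ppd_two.2 ⟨hp, ho, ?_, rfl⟩⟩
  have h2 : (2 : ZMod p) ≠ 0 := by
    intro h
    have : ((2 : ℕ) : ZMod p) = 0 := by exact_mod_cast h
    have h3 := (Nat.prime_dvd_prime_iff_eq hp Nat.prime_two).1 ((ZMod.natCast_eq_zero_iff _ _).1 this)
    subst h3
    exact absurd ho (by decide)
  have h1 : orderOf (2 : ZMod p) ≠ 1 := by
    rw [Ne, orderOf_eq_one_iff]
    intro h
    have : (1 : ZMod p) = 0 := by linear_combination h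
    exact one_ne_zero this
  have h0 : 0 < orderOf (2 : ZMod p) := orderOf_pos_iff.2
    ((isOfFinOrder_iff_pow_eq_one).2 ⟨p - 1, by have := hp.two_le; omega, ZMod.pow_card_sub_one_eq_one h2⟩)
  omega

/-- Adjacency of odd primes in the Gruenberg-Kegel graph of `GL_n(2)`. -/
theorem hasMatrixOrder_mul_iff {n r s k l : ℕ} (hr : r ∈ ppd 2 k) (hs : s ∈ ppd 2 l)
    (hrs : r ≠ s) (hk : k ≤ n) (hl : l ≤ n) :
    HasMatrixOrder n (r * s) ↔ k + l ≤ n ∨ k ∣ l ∨ l ∣ k := by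
  obtain ⟨hrp, hro, hk2, hrk⟩ := mem_ppd_two.1 hr
  obtain ⟨hsp, hso, hl2, hsl⟩ := mem_ppd_two.1 hs
  have hcop : Nat.Coprime r s := (Nat.coprime_primes hrp hsp).2 hrs
  have hrd := (prime_dvd_two_pow_sub_one_iff (l := k) hr).2 dvd_rfl
  have hsd := (prime_dvd_two_pow_sub_one_iff (l := l) hs).2 dvd_rfl
  constructor
  · intro h
    obtain ⟨x, y, hc, hx, hy, hx1, hy1⟩ := h.exists_commute hrp hsp
    have := orderOf_two_add_le_or_dvd hrp hro hsp hso hc hx hy hx1 hy1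
    simpa [hrk, hsl] using this
  · rintro (h | h | h)
    -- Two diagonal blocks when `k + l ≤ n`; in the divisibility cases a single field contains
    -- elements of both orders.
    · rw [← hcop.lcm_eq_mul]
      exact ((hasMatrixOrder_of_dvd (by omega) hrd).add
        (hasMatrixOrder_of_dvd (by omega) hsd)).mono h
    · exact (hasMatrixOrder_of_dvd (by omega)
        (hcop.mul_dvd_of_dvd_of_dvd ((prime_dvd_two_pow_sub_one_iff hr).2 h) hsd)).mono hl
    · exact (hasMatrixOrder_of_dvd (by omega)
        (hcop.mul_dvd_of_dvd_of_dvd hrd ((prime_dvd_two_pow_sub_one_iff hs).2 h))).mono hk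

/-- Adjacency to the vertex `2` in the Gruenberg-Kegel graph of `GL_n(2)`. -/
theorem hasMatrixOrder_mul_two_iff {n r k : ℕ} (hr : r ∈ ppd 2 k) :
    HasMatrixOrder n (r * 2) ↔ k + 2 ≤ n := by
  obtain ⟨hrp, hro, hk2, hrk⟩ := mem_ppd_two.1 hr
  constructor
  · intro h
    obtain ⟨x, y, hc, hx, hy, hx1, hy1⟩ := h.exists_commute hrp Nat.prime_two
    have := orderOf_two_add_two_le hrp hro hc hx hy hx1 hy1 (by omega)
    simpa [hrk] using this
  · intro h
    have hcop : Nat.Coprime r 2 := Nat.coprime_two_right.2 hro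
    rw [← hcop.lcm_eq_mul]
    exact ((hasMatrixOrder_of_dvd (by omega)
      ((prime_dvd_two_pow_sub_one_iff (l := k) hr).2 dvd_rfl)).add hasMatrixOrder_two_two).mono h

end PrimitiveDivisors

/-! ### Zsigmondy's theorem for base 2 through cyclotomic values. -/

section Zsigmondy

open Polynomial

theorem cyclotomic_eval_natCast_real (n b : ℕ) :
    (((cyclotomic n ℤ).eval (b : ℤ) : ℤ) : ℝ) = (cyclotomic n ℝ).eval (b : ℝ) := by
  have h := eval_intCast_map (Int.castRingHom ℝ) (cyclotomic n ℤ) (b : ℤ)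
  simpa using h.symm

/-- The shape of the index of a cyclotomic value at `2` in terms of a prime divisor. -/
theorem exists_pow_mul_orderOf_of_dvd_cyclotomic {n p : ℕ} (hn : n ≠ 0) (hp : p.Prime)
    (h : (p : ℤ) ∣ (cyclotomic n ℤ).eval 2) : ∃ a, n = p ^ a * orderOf (2 : ZMod p) := by
  have := Fact.mk hp
  obtain ⟨a, m, hpm, rfl⟩ := Nat.exists_eq_pow_mul_and_not_dvd hn p hp.ne_one
  have : NeZero (m : ZMod p) := ⟨by rwa [Ne, ZMod.natCast_eq_zero_iff]⟩
  refine ⟨a, ?_⟩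
  have hroot : (cyclotomic (p ^ a * m) (ZMod p)).IsRoot 2 := by
    have h1 := eval_intCast_map (Int.castRingHom (ZMod p)) (cyclotomic (p ^ a * m) ℤ) 2
    have h2 := (ZMod.intCast_zmod_eq_zero_iff_dvd _ p).2 h
    rw [map_cyclotomic] at h1
    rw [IsRoot.def]
    simpa [h2] using h1
  rw [isRoot_cyclotomic_prime_pow_mul_iff_of_charP] at hroot
  rw [← hroot.eq_orderOf]

/-- `(2 ^ m - 1) * Φ_{mp}(2)` divides `2 ^ (m * p) - 1`, whose `p`-adic valuation exceeds that of `2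
^ m - 1` by exactly one (lifting the exponent). -/
theorem not_sq_dvd_cyclotomic_eval_two {m p : ℕ} (hm : m ≠ 0) (hp : p.Prime) (ho : Odd p)
    (hd : p ∣ 2 ^ m - 1) : ¬ ((p : ℤ) ^ 2 ∣ (cyclotomic (m * p) ℤ).eval 2) := by
  intro h
  have hprop : m ∈ (m * p).properDivisors :=
    Nat.mem_properDivisors.2 ⟨Dvd.intro p rfl,
      lt_mul_of_one_lt_right (Nat.pos_of_ne_zero hm) hp.one_lt⟩
  have h1 := map_dvd (evalRingHom (2 : ℤ))
    (X_pow_sub_one_mul_cyclotomic_dvd_X_pow_sub_one_of_dvd ℤ hprop)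
  simp only [coe_evalRingHom, eval_mul, eval_sub, eval_pow, eval_X, eval_one] at h1
  have hd' : (p : ℤ) ∣ 2 ^ m - 1 := by
    have := Int.natCast_dvd_natCast.2 hd
    rwa [Nat.cast_sub Nat.one_le_two_pow, Nat.cast_pow, Nat.cast_one, Nat.cast_ofNat] at this
  have hnd : ¬ (p : ℤ) ∣ 2 ^ m := by
    intro h2
    have h3 : (p : ℤ) ∣ 1 := by simpa using dvd_sub h2 hd'
    exact hp.one_lt.ne' (Nat.dvd_one.1 (by exact_mod_cast h3))
  have hlte := Int.emultiplicity_pow_sub_pow hp ho (x := 2 ^ m) (y := 1) hd' hnd p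
  rw [one_pow, ← pow_mul] at hlte
  have h2 := emultiplicity_le_emultiplicity_of_dvd_right (a := (p : ℤ)) h1
  rw [emultiplicity_mul (Nat.prime_iff_prime_int.1 hp), hlte] at h2
  have hfin : emultiplicity (p : ℤ) (2 ^ m - 1) ≠ ⊤ := by
    rw [← finiteMultiplicity_iff_emultiplicity_ne_top, Int.finiteMultiplicity_iff]
    refine ⟨by simpa using hp.ne_one, ?_⟩
    have : (2 : ℤ) ^ 1 ≤ 2 ^ m := pow_le_pow_right₀ (by norm_num) (Nat.pos_of_ne_zero hm)
    omega
  have h3 := (ENat.add_le_add_iff_left hfin).1 h2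
  have h4 := le_emultiplicity_of_pow_dvd h
  have h5 : emultiplicity p p = 1 := by
    have := (Nat.finiteMultiplicity_iff.2 ⟨hp.ne_one, hp.pos⟩).emultiplicity_self
    exact this
  rw [h5] at h3
  have := h4.trans h3
  norm_num at this

theorem three_mul_le_two_pow_sub_one {p : ℕ} (hp : 5 ≤ p) : 3 * p + 1 ≤ 2 ^ p := by
  induction p, hp using Nat.le_induction with
  | base => norm_num
  | succ p hp ih => rw [pow_succ]; omega

/-- `Φ_m(2 ^ p)` equals `Φ_{mp}(2)`, times `Φ_m(2)` when `p ∤ m`. It exceeds `(2 ^ p - 1) ^ φ(m) ≥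
(3 * p) ^ φ(m)`, while `Φ_m(2) < 3 ^ φ(m)`; hence the constant 3. -/
theorem lt_cyclotomic_eval_two {m p : ℕ} (hm : 3 ≤ m) (hp : p.Prime) (h5 : 5 ≤ p) :
    (p : ℤ) < (cyclotomic (m * p) ℤ).eval 2 := by
  have h2p : ((3 * p : ℕ) : ℝ) ≤ ((2 ^ p : ℕ) : ℝ) - 1 := by
    have := three_mul_le_two_pow_sub_one h5
    have h : ((3 * p + 1 : ℕ) : ℝ) ≤ ((2 ^ p : ℕ) : ℝ) := by exact_mod_cast this
    push_cast at h ⊢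
    linarith
  have hp1 : (1 : ℝ) ≤ p := by exact_mod_cast hp.pos
  have hφ : m.totient ≠ 0 := (Nat.totient_pos.2 (by omega)).ne'
  have hbig := sub_one_pow_totient_lt_cyclotomic_eval (n := m) (q := ((2 ^ p : ℕ) : ℝ)) (by omega)
    (by push_cast at h2p ⊢; linarith)
  have hlow : (3 * (p : ℝ)) ^ m.totient < (cyclotomic m ℝ).eval ((2 ^ p : ℕ) : ℝ) := by
    refine lt_of_le_of_lt ?_ hbig
    push_cast at h2p ⊢
    exact pow_le_pow_left₀ (by positivity) h2p _
  have hcast := cyclotomic_eval_natCast_real (m * p) 2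
  rw [Nat.cast_ofNat, Nat.cast_ofNat] at hcast
  have hgoal : (p : ℝ) < (cyclotomic (m * p) ℝ).eval 2 := by
    by_cases hpm : p ∣ m
    · have he := congrArg (eval (2 : ℝ)) (cyclotomic_expand_eq_cyclotomic hp hpm ℝ)
      rw [expand_eval] at he
      rw [← he]
      push_cast at hlow
      refine lt_of_le_of_lt ?_ hlow
      have := le_self_pow₀ (a := 3 * (p : ℝ)) (by linarith) hφ
      linarith
    · have he := congrArg (eval (2 : ℝ)) (cyclotomic_expand_eq_cyclotomic_mul hp hpm ℝ)
      rw [expand_eval, eval_mul] at he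
      have hup := cyclotomic_eval_lt_add_one_pow_totient (q := 2) hm (by norm_num)
      have hpos := cyclotomic_pos' m (by norm_num : (1 : ℝ) < 2)
      push_cast at hlow
      rw [he, mul_pow] at hlow
      have h1 := le_self_pow₀ hp1 hφ
      norm_num at hup
      by_contra! hcon
      have h3 : (0 : ℝ) < 3 ^ m.totient := by positivity
      have a1 : eval 2 (cyclotomic (m * p) ℝ) * eval 2 (cyclotomic m ℝ)
          ≤ p * eval 2 (cyclotomic m ℝ) := mul_le_mul_of_nonneg_right hcon hpos.le
      have a2 : p * eval 2 (cyclotomic m ℝ) ≤ p * 3 ^ m.totient :=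
        mul_le_mul_of_nonneg_left hup.le (by linarith)
      have a3 : p * (3 : ℝ) ^ m.totient ≤ p ^ m.totient * 3 ^ m.totient :=
        mul_le_mul_of_nonneg_right h1 h3.le
      linarith
  rw [← hcast] at hgoal
  exact_mod_cast hgoal

/-- Zsigmondy's theorem for base `2` and odd exponents. -/
theorem ppd_two_nonempty_of_odd {n : ℕ} (ho : Odd n) (hn : 3 ≤ n) : (ppd 2 n).Nonempty := by
  by_contra hemp
  rw [Finset.not_nonempty_iff_eq_empty] at hemp
  obtain ⟨N, hN⟩ : ∃ N : ℕ, (N : ℤ) = (cyclotomic n ℤ).eval 2 :=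
    ⟨_, Int.toNat_of_nonneg (cyclotomic_pos' n (by norm_num)).le⟩
  have hN1 : N ≠ 1 := by
    rintro rfl
    have h := sub_one_pow_totient_lt_cyclotomic_eval (n := n) (q := 2) (by omega) (by norm_num)
    have hcast := cyclotomic_eval_natCast_real n 2
    rw [Nat.cast_ofNat, Nat.cast_ofNat, ← hN] at hcast
    rw [← hcast] at h
    norm_num at h
  have hdvd : (N : ℤ) ∣ 2 ^ n - 1 := by
    have := map_dvd (evalRingHom (2 : ℤ)) (cyclotomic.dvd_X_pow_sub_one n ℤ)
    simpa [hN] using this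
  have hNn : N ∣ 2 ^ n - 1 := by
    rw [← Int.natCast_dvd_natCast, Nat.cast_sub Nat.one_le_two_pow]
    simpa using hdvd
  -- Without primitive divisors of index `n`, every prime `q` dividing `Φ_n(2)` has index `k < q`
  -- with `n = q ^ a * k` and `a ≥ 1`.
  have key : ∀ q : ℕ, q.Prime → q ∣ N → Odd q ∧ ∃ m k, n = m * q ∧ q ∈ ppd 2 k ∧ k ∣ m ∧
      k < q ∧ ∃ a, n = q ^ a * k := by
    intro q hq hqN
    have hqd := hqN.trans hNn
    have hqo : Odd q := by
      rcases hq.eq_two_or_odd' with rfl | h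
      · have : 2 ∣ 2 ^ n := dvd_pow_self 2 (by omega)
        have := Nat.one_le_two_pow (n := n)
        omega
      · exact h
    refine ⟨hqo, ?_⟩
    obtain ⟨k, hk⟩ := exists_mem_ppd_two hq hqo
    obtain ⟨a, ha⟩ := exists_pow_mul_orderOf_of_dvd_cyclotomic (n := n) (by omega) hq
      (hN ▸ Int.natCast_dvd_natCast.2 hqN)
    rw [(mem_ppd_two.1 hk).2.2.2] at ha
    rcases a with _ | a
    · rw [pow_zero, one_mul] at ha
      subst ha
      rw [hemp] at hk
      simp at hk
    · have hk2 := (mem_ppd_two.1 hk).2.2.1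
      have hkq : k ∣ q - 1 := by
        have := Fact.mk hq
        rw [← (mem_ppd_two.1 hk).2.2.2]
        apply ZMod.orderOf_dvd_card_sub_one
        intro h0
        have h1 : ((2 : ℕ) : ZMod q) = 0 := by exact_mod_cast h0
        have h2 := (Nat.prime_dvd_prime_iff_eq hq Nat.prime_two).1
          ((ZMod.natCast_eq_zero_iff _ _).1 h1)
        subst h2
        exact absurd hqo (by decide)
      have hkle := Nat.le_of_dvd (by have := hq.two_le; omega) hkq
      have := hq.two_le
      exact ⟨q ^ a * k, k, by rw [ha]; ring, hk, Dvd.intro_left _ rfl, by omega, a + 1, ha⟩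
  obtain ⟨p, hp, hpN⟩ := Nat.exists_prime_and_dvd hN1
  obtain ⟨hpo, m, k, hnm, hpk, hkm, hkp, a, hna⟩ := key p hp hpN
  have hm0 : m ≠ 0 := by rintro rfl; omega
  -- Oddness of `n` forces `k ≥ 3` and `p ≥ 5`, which excludes the exception `n = 6` with `p = 3`,
  -- `k = 2`.
  have hko : Odd k := (Nat.odd_mul.1 (hna.subst ho : Odd (p ^ a * k))).2
  have hk3 : 3 ≤ k := by
    have := (mem_ppd_two.1 hpk).2.2.1
    rcases hko with ⟨j, rfl⟩
    omega
  have hm3 : 3 ≤ m := hk3.trans (Nat.le_of_dvd (Nat.pos_of_ne_zero hm0) hkm)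
  have h5 : 5 ≤ p := by
    rcases hpo with ⟨j, rfl⟩
    omega
  -- A second prime `q` would divide `k < p` while `p` divides `k' < q`; a repeated `p` is excluded
  -- by the valuation bound.
  have hNp : N = p := by
    obtain ⟨N', hN'⟩ := hpN
    by_contra hne
    have hN'1 : N' ≠ 1 := by rintro rfl; omega
    obtain ⟨q, hq, hqN'⟩ := Nat.exists_prime_and_dvd hN'1
    obtain ⟨hqo, m', k', hnm', hqk', hkm', hkq', a', hna'⟩ :=
      key q hq (hN' ▸ hqN'.mul_left p)
    by_cases hqp : q = p
    · subst hqp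
      refine not_sq_dvd_cyclotomic_eval_two hm0 hp hpo
        ((prime_dvd_two_pow_sub_one_iff hpk).2 hkm) ?_
      rw [← hnm, ← hN, hN', sq]
      exact_mod_cast mul_dvd_mul_left q hqN'
    · have h1 : q ∣ k := by
        have : q ∣ p ^ a * k := hna ▸ hnm' ▸ Dvd.intro_left m' rfl
        exact (hq.dvd_mul.1 this).resolve_left fun h =>
          hqp ((Nat.prime_dvd_prime_iff_eq hq hp).1 (hq.dvd_of_dvd_pow h))
      have h2 : p ∣ k' := by
        have : p ∣ q ^ a' * k' := hna' ▸ hnm ▸ Dvd.intro_left m rfl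
        exact (hp.dvd_mul.1 this).resolve_left fun h =>
          hqp ((Nat.prime_dvd_prime_iff_eq hp hq).1 (hp.dvd_of_dvd_pow h)).symm
      have h3 := Nat.le_of_dvd (by omega) h1
      have h4 := Nat.le_of_dvd (by have := (mem_ppd_two.1 hqk').2.2.1; omega) h2
      omega
  have := lt_cyclotomic_eval_two hm3 hp h5
  rw [← hnm, ← hN, hNp] at this
  exact lt_irrefl _ this

theorem exists_mem_ppd_two_consecutive {n : ℕ} (hn : 3 ≤ n) :
    ∃ k q, (k = n ∨ k = n - 1) ∧ q ∈ ppd 2 k := by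
  rcases Nat.even_or_odd n with he | ho
  · have ho : Odd (n - 1) := Nat.Even.sub_odd (by omega) he odd_one
    have hn4 : 3 ≤ n - 1 := by
      rcases he with ⟨j, rfl⟩
      omega
    obtain ⟨q, hq⟩ := ppd_two_nonempty_of_odd ho hn4
    exact ⟨n - 1, q, Or.inr rfl, hq⟩
  · obtain ⟨q, hq⟩ := ppd_two_nonempty_of_odd ho hn
    exact ⟨n, q, Or.inl rfl, hq⟩

end Zsigmondy

/-! ### Reduction from the projective group to matrices. -/

section ProjectiveSpecialLinear

theorem zmod_two_eq_one_of_ne_zero (a : ZMod 2) (h : a ≠ 0) : a = 1 := by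
  revert a
  decide

theorem center_specialLinearGroup_zmod_two {n : ℕ} (hn : n ≠ 0) :
    Subgroup.center (Matrix.SpecialLinearGroup (Fin n) (ZMod 2)) = ⊥ := by
  rw [eq_bot_iff]
  intro A hA
  obtain ⟨r, hr, hA⟩ := Matrix.SpecialLinearGroup.mem_center_iff.1 hA
  have hr0 : r ≠ 0 := by
    rintro rfl
    rw [Fintype.card_fin, zero_pow hn] at hr
    exact zero_ne_one hr
  rw [zmod_two_eq_one_of_ne_zero r hr0, map_one] at hA
  exact Subgroup.mem_bot.2 (Subtype.ext hA.symm)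

/-- `PSL_n(2)` is isomorphic to `SL_n(2)`. -/
noncomputable def projSL2EquivSL {n : ℕ} (hn : n ≠ 0) :
    projSL2 n ≃* Matrix.SpecialLinearGroup (Fin n) (ZMod 2) :=
  (QuotientGroup.quotientMulEquivOfEq (center_specialLinearGroup_zmod_two hn)).trans
    QuotientGroup.quotientBot

theorem card_projSL2 {n : ℕ} (hn : n ≠ 0) :
    Nat.card (projSL2 n) = ∏ i : Fin n, (2 ^ n - 2 ^ (i : ℕ)) := by
  have h := Matrix.card_GL_field (𝔽 := ZMod 2) n
  rw [ZMod.card] at h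
  rw [← h, Nat.card_congr (projSL2EquivSL hn).toEquiv]
  refine Nat.card_eq_of_bijective
    (Matrix.SpecialLinearGroup.toGL (n := Fin n) (R := ZMod 2)) ⟨?_, ?_⟩
  · intro A B h
    exact Subtype.ext (congrArg Units.val h)
  · intro g
    refine ⟨⟨g, zmod_two_eq_one_of_ne_zero _ ?_⟩, Units.ext rfl⟩
    exact ((Matrix.isUnit_iff_isUnit_det _).1 g.isUnit).ne_zero

theorem exists_orderOf_projSL2_iff {n m : ℕ} (hn : n ≠ 0) (hm : m ≠ 0) :
    (∃ g : projSL2 n, orderOf g = m) ↔ HasMatrixOrder n m := by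
  constructor
  · rintro ⟨g, hg⟩
    refine ⟨(projSL2EquivSL hn g : Matrix (Fin n) (Fin n) (ZMod 2)), ?_⟩
    rw [← hg, ← (projSL2EquivSL hn).orderOf_eq g]
    exact orderOf_injective (Matrix.SpecialLinearGroup.coeMonoidHom (ι := Fin n) (R := ZMod 2))
      Subtype.val_injective _
  · rintro ⟨A, hA⟩
    have hu : IsUnit A := IsUnit.of_pow_eq_one (hA ▸ pow_orderOf_eq_one A) hm
    let B : Matrix.SpecialLinearGroup (Fin n) (ZMod 2) :=
      ⟨A, zmod_two_eq_one_of_ne_zero _ ((Matrix.isUnit_iff_isUnit_det _).1 hu).ne_zero⟩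
    refine ⟨(projSL2EquivSL hn).symm B, ?_⟩
    rw [(projSL2EquivSL hn).symm.orderOf_eq, ← hA]
    exact (orderOf_injective (Matrix.SpecialLinearGroup.coeMonoidHom (ι := Fin n) (R := ZMod 2))
      Subtype.val_injective B).symm

theorem mem_primeSet_projSL2 {n q : ℕ} (hn : 2 ≤ n) :
    q ∈ primeSet (projSL2 n) ↔ q = 2 ∨ ∃ k ≤ n, q ∈ ppd 2 k := by
  have hfac : ∀ i : Fin n, 2 ^ n - 2 ^ (i : ℕ) = 2 ^ (i : ℕ) * (2 ^ (n - i) - 1) := by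
    intro i
    rw [Nat.mul_sub, ← pow_add, Nat.add_sub_cancel' i.2.le, mul_one]
  have hcard : Nat.card (projSL2 n) ≠ 0 := Nat.card_pos.ne'
  rw [primeSet, Nat.mem_primeFactors, and_iff_left hcard, card_projSL2 (by omega)]
  constructor
  · rintro ⟨hq, hd⟩
    rcases hq.eq_two_or_odd' with h2 | ho
    · exact Or.inl h2
    right
    obtain ⟨i, -, hi⟩ := (hq.prime.dvd_finsetProd_iff _).1 hd
    rw [hfac, hq.dvd_mul] at hi
    have hi' : q ∣ 2 ^ (n - i) - 1 := by
      refine hi.resolve_left fun h => ?_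
      have := (Nat.prime_dvd_prime_iff_eq hq Nat.prime_two).1 (hq.dvd_of_dvd_pow h)
      subst this
      exact absurd ho (by decide)
    obtain ⟨k, hk⟩ := exists_mem_ppd_two hq ho
    have := Nat.le_of_dvd (by omega) ((prime_dvd_two_pow_sub_one_iff hk).1 hi')
    exact ⟨k, by omega, hk⟩
  · rintro (rfl | ⟨k, hkn, hk⟩)
    · refine ⟨Nat.prime_two, (Nat.prime_two.prime.dvd_finsetProd_iff _).2
        ⟨⟨1, by omega⟩, Finset.mem_univ _, ?_⟩⟩
      rw [hfac]
      exact (dvd_pow_self 2 one_ne_zero).mul_right _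
    · have h := mem_ppd_two.1 hk
      -- The factor with `i = n - k` is `2 ^ (n - k) * (2 ^ k - 1)`.
      refine ⟨h.1, (h.1.prime.dvd_finsetProd_iff _).2
        ⟨⟨n - k, by omega⟩, Finset.mem_univ _, ?_⟩⟩
      rw [hfac]
      refine Dvd.dvd.mul_left ((prime_dvd_two_pow_sub_one_iff hk).2 ?_) _
      simp [Nat.sub_sub_self hkn]

end ProjectiveSpecialLinear

/-! ### Degrees as cardinalities of sets of primes. -/

section Degrees

open Classical in
theorem gkDegree_eq_card (G : Type*) [Group G] [Finite G] (p : primeSet G) {S : Finset ℕ}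
    (hS : ∀ q, q ∈ S ↔ q ∈ primeSet G ∧ (p : ℕ) ≠ q ∧ ∃ g : G, orderOf g = p * q) :
    gkDegree G p = S.card := by
  rw [gkDegree, ← SimpleGraph.card_neighborFinset_eq_degree]
  refine Finset.card_bij (fun q _ => (q : ℕ)) ?_ (fun _ _ _ _ h => Subtype.ext h) ?_
  · intro q hq
    rw [SimpleGraph.mem_neighborFinset] at hq
    exact (hS q).2 ⟨q.2, fun h => hq.1 (Subtype.ext h), hq.2⟩
  · intro q hq
    obtain ⟨h1, h2, h3⟩ := (hS q).1 hq
    refine ⟨⟨q, h1⟩, ?_, rfl⟩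
    rw [SimpleGraph.mem_neighborFinset]
    exact ⟨fun h => h2 (congrArg Subtype.val h), h3⟩

theorem two_notMem_ppd_two (k : ℕ) : 2 ∉ ppd 2 k := fun h =>
  absurd (mem_ppd_two.1 h).2.1 (by decide)

theorem mem_primeFactors_two_pow_sub_one {k q : ℕ} (hk : 2 ≤ k) :
    q ∈ (2 ^ k - 1).primeFactors ↔ ∃ l, l ∣ k ∧ q ∈ ppd 2 l := by
  have hpos : 2 ^ k - 1 ≠ 0 := by
    have := Nat.pow_le_pow_right (n := 2) two_pos hk
    omega
  rw [Nat.mem_primeFactors]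
  constructor
  · rintro ⟨hq, hd, -⟩
    have ho : Odd q := by
      rcases hq.eq_two_or_odd' with rfl | h
      · have : 2 ∣ 2 ^ k := dvd_pow_self 2 (by omega)
        have := Nat.one_le_two_pow (n := k)
        omega
      · exact h
    obtain ⟨l, hl⟩ := exists_mem_ppd_two hq ho
    exact ⟨l, (prime_dvd_two_pow_sub_one_iff hl).1 hd, hl⟩
  · rintro ⟨l, hl, hq⟩
    exact ⟨(mem_ppd_two.1 hq).1, (prime_dvd_two_pow_sub_one_iff hq).2 hl, hpos⟩

theorem gkDegree_projSL2_two {n : ℕ} (hn : 2 ≤ n) (h2 : 2 ∈ primeSet (projSL2 n)) {S : Finset ℕ}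
    (hS : ∀ q, q ∈ S ↔ ∃ l, l + 2 ≤ n ∧ q ∈ ppd 2 l) :
    gkDegree (projSL2 n) ⟨2, h2⟩ = S.card := by
  apply gkDegree_eq_card
  intro q
  rw [hS, mem_primeSet_projSL2 hn]
  constructor
  · rintro ⟨l, hl, hq⟩
    refine ⟨Or.inr ⟨l, by omega, hq⟩, ?_, ?_⟩
    · rintro rfl
      exact two_notMem_ppd_two l hq
    · rw [exists_orderOf_projSL2_iff (by omega)
        (Nat.mul_ne_zero two_ne_zero (mem_ppd_two.1 hq).1.ne_zero), mul_comm,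
        hasMatrixOrder_mul_two_iff hq]
      exact hl
  · rintro ⟨rfl | ⟨l, hl, hq⟩, hne, hg⟩
    · exact absurd rfl hne
    · rw [exists_orderOf_projSL2_iff (by omega)
        (Nat.mul_ne_zero two_ne_zero (mem_ppd_two.1 hq).1.ne_zero), mul_comm,
        hasMatrixOrder_mul_two_iff hq] at hg
      exact ⟨l, hg, hq⟩

theorem gkDegree_projSL2_odd {n k : ℕ} (hn : 2 ≤ n) (r : primeSet (projSL2 n))
    (hr : (r : ℕ) ∈ ppd 2 k) (hk : k ≤ n) {S : Finset ℕ}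
    (hS : ∀ q, q ∈ S ↔ (q = 2 ∧ k + 2 ≤ n) ∨
      (q ≠ r ∧ ∃ l ≤ n, q ∈ ppd 2 l ∧ (k + l ≤ n ∨ k ∣ l ∨ l ∣ k))) :
    gkDegree (projSL2 n) r = S.card := by
  apply gkDegree_eq_card
  intro q
  have hr0 := (mem_ppd_two.1 hr).1.ne_zero
  rw [hS, mem_primeSet_projSL2 hn]
  constructor
  · rintro (⟨rfl, h⟩ | ⟨hne, l, hl, hq, h⟩)
    · refine ⟨Or.inl rfl, ?_, ?_⟩
      · intro h2
        rw [h2] at hr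
        exact two_notMem_ppd_two k hr
      · rwa [exists_orderOf_projSL2_iff (by omega) (Nat.mul_ne_zero hr0 two_ne_zero),
          hasMatrixOrder_mul_two_iff hr]
    · refine ⟨Or.inr ⟨l, hl, hq⟩, hne.symm, ?_⟩
      rwa [exists_orderOf_projSL2_iff (by omega)
        (Nat.mul_ne_zero hr0 (mem_ppd_two.1 hq).1.ne_zero),
        hasMatrixOrder_mul_iff hr hq hne.symm hk hl]
  · rintro ⟨rfl | ⟨l, hl, hq⟩, hne, hg⟩
    · rw [exists_orderOf_projSL2_iff (by omega) (Nat.mul_ne_zero hr0 two_ne_zero),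
        hasMatrixOrder_mul_two_iff hr] at hg
      exact Or.inl ⟨rfl, hg⟩
    · rw [exists_orderOf_projSL2_iff (by omega)
        (Nat.mul_ne_zero hr0 (mem_ppd_two.1 hq).1.ne_zero),
        hasMatrixOrder_mul_iff hr hq hne hk hl] at hg
      exact Or.inr ⟨hne.symm, l, hl, hq, hg⟩

theorem mem_biUnion_ppd_two {m q : ℕ} :
    q ∈ (Finset.Icc 2 m).biUnion (ppd 2) ↔ ∃ l ≤ m, q ∈ ppd 2 l := by
  simp only [Finset.mem_biUnion, Finset.mem_Icc]
  constructor
  · rintro ⟨l, hl, hq⟩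
    exact ⟨l, hl.2, hq⟩
  · rintro ⟨l, hl, hq⟩
    exact ⟨l, ⟨(mem_ppd_two.1 hq).2.2.1, hl⟩, hq⟩

end Degrees

/-! ### The degree formulas and the independence bound. -/

section Formulas

theorem gkDegree_projSL2_two_eq {n : ℕ} (hn : 3 ≤ n) (h2 : 2 ∈ primeSet (projSL2 n)) :
    (gkDegree (projSL2 n) ⟨2, h2⟩ : ℤ) =
      ((primeSet (projSL2 n)).card : ℤ) - ((ppd 2 (n - 1) ∪ ppd 2 n).card : ℤ) - 1 := by
  have hsub : insert 2 (ppd 2 (n - 1) ∪ ppd 2 n) ⊆ primeSet (projSL2 n) := by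
    intro q hq
    rw [mem_primeSet_projSL2 (by omega)]
    rcases Finset.mem_insert.1 hq with rfl | hq
    · exact Or.inl rfl
    rcases Finset.mem_union.1 hq with hq | hq
    · exact Or.inr ⟨n - 1, by omega, hq⟩
    · exact Or.inr ⟨n, le_rfl, hq⟩
  rw [gkDegree_projSL2_two (by omega) h2
    (S := primeSet (projSL2 n) \ insert 2 (ppd 2 (n - 1) ∪ ppd 2 n)),
    Finset.cast_card_sdiff hsub, Finset.card_insert_of_notMem]
  · push_cast
    ring
  · rw [Finset.mem_union]
    rintro (h | h) <;> exact two_notMem_ppd_two _ h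
  · intro q
    rw [Finset.mem_sdiff, mem_primeSet_projSL2 (by omega), Finset.mem_insert, Finset.mem_union]
    constructor
    · rintro ⟨rfl | ⟨l, hl, hq⟩, h⟩
      · exact absurd (Or.inl rfl) h
      · refine ⟨l, ?_, hq⟩
        by_contra hcon
        obtain rfl | rfl : l = n - 1 ∨ l = n := by omega
        · exact h (Or.inr (Or.inl hq))
        · exact h (Or.inr (Or.inr hq))
    · rintro ⟨l, hl, hq⟩
      refine ⟨Or.inr ⟨l, by omega, hq⟩, ?_⟩
      rintro (rfl | h | h)
      · exact two_notMem_ppd_two l hq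
      · have := ppd_two_index_unique hq h
        omega
      · have := ppd_two_index_unique hq h
        omega

theorem le_gkIndepNumAt {G : Type*} [Group G] [Finite G] {r : primeSet G}
    {s : Finset (primeSet G)} (hr : r ∈ s) (hs : (gkGraph G).IsIndepSet s) :
    s.card ≤ gkIndepNumAt G r := by
  -- Boundedness matters: `sSup` of an unbounded set of naturals is 0.
  refine le_csSup ⟨Fintype.card (primeSet G), ?_⟩ ⟨s, hr, ⟨hs, rfl⟩⟩
  rintro m ⟨t, -, ht⟩
  rw [← ht.card_eq]
  exact Finset.card_le_univ t

theorem two_le_gkIndepNumAt_projSL2_two {n : ℕ} (hn : 3 ≤ n) (h2 : 2 ∈ primeSet (projSL2 n)) :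
    2 ≤ gkIndepNumAt (projSL2 n) ⟨2, h2⟩ := by
  obtain ⟨k, q, hk, hq⟩ := exists_mem_ppd_two_consecutive hn
  have hqm : q ∈ primeSet (projSL2 n) :=
    (mem_primeSet_projSL2 (by omega)).2 (Or.inr ⟨k, by omega, hq⟩)
  have hne : (⟨2, h2⟩ : primeSet (projSL2 n)) ≠ ⟨q, hqm⟩ := by
    intro h
    have h' : 2 = q := congrArg Subtype.val h
    rw [← h'] at hq
    exact two_notMem_ppd_two k hq
  have hnadj : ¬ (gkGraph (projSL2 n)).Adj ⟨q, hqm⟩ ⟨2, h2⟩ := by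
    rintro ⟨-, hg⟩
    rw [exists_orderOf_projSL2_iff (by omega)
      (Nat.mul_ne_zero (mem_ppd_two.1 hq).1.ne_zero two_ne_zero),
      hasMatrixOrder_mul_two_iff hq] at hg
    omega
  refine (Finset.card_pair hne).symm.le.trans ?_
  refine le_gkIndepNumAt (Finset.mem_insert_self _ _) ?_
  intro a ha b hb hab
  simp only [Finset.coe_insert, Finset.coe_singleton, Set.mem_insert_iff,
    Set.mem_singleton_iff] at ha hb
  rcases ha with rfl | rfl <;> rcases hb with rfl | rfl
  · exact absurd rfl hab
  · exact fun h => hnadj h.symm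
  · exact hnadj
  · exact absurd rfl hab

theorem self_mem_primeFactors_two_pow_sub_one {r k : ℕ} (hr : r ∈ ppd 2 k) :
    r ∈ (2 ^ k - 1).primeFactors :=
  (mem_primeFactors_two_pow_sub_one (mem_ppd_two.1 hr).2.2.1).2 ⟨k, dvd_rfl, hr⟩

/-- Here `k + l ≤ n` fails for every `l ≥ 2`, and `2 * k > n` leaves only `l = k` among multiples of
`k`; so the neighbours have index dividing `k`. -/
theorem gkDegree_projSL2_odd_top {n k : ℕ} (hn : 3 ≤ n) (r : primeSet (projSL2 n))
    (hr : (r : ℕ) ∈ ppd 2 k) (hk : k = n ∨ k = n - 1) :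
    (gkDegree (projSL2 n) r : ℤ) = ((2 ^ k - 1).primeFactors.card : ℤ) - 1 := by
  have hk2 := (mem_ppd_two.1 hr).2.2.1
  rw [gkDegree_projSL2_odd (by omega) r hr (by omega) (S := (2 ^ k - 1).primeFactors.erase r),
    Finset.cast_card_erase_of_mem (self_mem_primeFactors_two_pow_sub_one hr)]
  intro q
  rw [Finset.mem_erase, mem_primeFactors_two_pow_sub_one hk2]
  constructor
  · rintro ⟨hne, l, hl, hq⟩
    have := Nat.le_of_dvd (by omega) hl
    exact Or.inr ⟨hne, l, by omega, hq, Or.inr (Or.inr hl)⟩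
  · rintro (⟨-, h⟩ | ⟨hne, l, hl, hq, h⟩)
    · omega
    · refine ⟨hne, l, ?_, hq⟩
      have hl2 := (mem_ppd_two.1 hq).2.2.1
      rcases h with h | ⟨c, rfl⟩ | h
      · omega
      · rcases c with _ | _ | c
        · omega
        · simp
        · rw [show k * (c + 1 + 1) = k * c + k + k by ring] at hl
          omega
      · exact h

/-- The only multiple of `k` in `(n - k, n]` is `n / k * k`, and divisors of `k` are at most `n -
k`. The neighbour 2 makes up for removing `r`, so no 1 is subtracted. -/
theorem gkDegree_projSL2_odd_low {n k : ℕ} (hn : 3 ≤ n) (r : primeSet (projSL2 n))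
    (hr : (r : ℕ) ∈ ppd 2 k) (hk : 2 * k ≤ n) (hkn : k + 2 ≤ n) :
    gkDegree (projSL2 n) r =
      ((Finset.Icc 2 (n - k)).biUnion (ppd 2)).card + (ppd 2 (n / k * k)).card := by
  have hk2 := (mem_ppd_two.1 hr).2.2.1
  have hdiv : n / k * k ≤ n := Nat.div_mul_le_self n k
  have hlt : n < n / k * k + k := Nat.lt_div_mul_add (by omega)
  have hrB : (r : ℕ) ∈ (Finset.Icc 2 (n - k)).biUnion (ppd 2) :=
    mem_biUnion_ppd_two.2 ⟨k, by omega, hr⟩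
  have h2B : 2 ∉ ((Finset.Icc 2 (n - k)).biUnion (ppd 2)).erase r := by
    intro h
    obtain ⟨l, -, hl⟩ := mem_biUnion_ppd_two.1 (Finset.mem_of_mem_erase h)
    exact two_notMem_ppd_two l hl
  have hdisj : Disjoint (insert 2 (((Finset.Icc 2 (n - k)).biUnion (ppd 2)).erase r))
      (ppd 2 (n / k * k)) := by
    rw [Finset.disjoint_left]
    intro q hq hq'
    rcases Finset.mem_insert.1 hq with rfl | hq
    · exact two_notMem_ppd_two _ hq'
    · obtain ⟨l, hl, hql⟩ := mem_biUnion_ppd_two.1 (Finset.mem_of_mem_erase hq)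
      have := ppd_two_index_unique hql hq'
      omega
  rw [gkDegree_projSL2_odd (by omega) r hr (by omega) (S :=
    insert 2 (((Finset.Icc 2 (n - k)).biUnion (ppd 2)).erase r) ∪ ppd 2 (n / k * k)),
    Finset.card_union_of_disjoint hdisj, Finset.card_insert_of_notMem h2B,
    Finset.card_erase_add_one hrB]
  intro q
  rw [Finset.mem_union, Finset.mem_insert, Finset.mem_erase, mem_biUnion_ppd_two]
  constructor
  · rintro ((rfl | ⟨hne, l, hl, hq⟩) | hq)
    · exact Or.inl ⟨rfl, hkn⟩
    · exact Or.inr ⟨hne, l, by omega, hq, Or.inl (by omega)⟩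
    · refine Or.inr ⟨?_, _, hdiv, hq, Or.inr (Or.inl (Nat.dvd_mul_left k _))⟩
      rintro rfl
      have := ppd_two_index_unique hq hr
      omega
  · rintro (⟨rfl, -⟩ | ⟨hne, l, hl, hq, h⟩)
    · exact Or.inl (Or.inl rfl)
    · by_cases hln : l ≤ n - k
      · exact Or.inl (Or.inr ⟨hne, l, hln, hq⟩)
      · right
        rcases h with h | ⟨c, rfl⟩ | h
        · omega
        · have hc : n / k = c := by
            apply Nat.div_eq_of_lt_le
            · rw [mul_comm]; exact hl
            · rw [add_mul, one_mul, mul_comm c k]; omega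
          rwa [hc, mul_comm]
        · have := Nat.le_of_dvd (by omega) h
          obtain rfl : l = k := by omega
          omega

theorem gkDegree_projSL2_odd_high {n k : ℕ} (hn : 3 ≤ n) (r : primeSet (projSL2 n))
    (hr : (r : ℕ) ∈ ppd 2 k) (hk : n < 2 * k) (hkn : k + 2 ≤ n) :
    gkDegree (projSL2 n) r =
      ((2 ^ k - 1).primeFactors ∪ (Finset.Icc 2 (n - k)).biUnion (ppd 2)).card := by
  have hk2 := (mem_ppd_two.1 hr).2.2.1
  have hrB : (r : ℕ) ∈ (2 ^ k - 1).primeFactors ∪ (Finset.Icc 2 (n - k)).biUnion (ppd 2) :=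
    Finset.mem_union_left _ (self_mem_primeFactors_two_pow_sub_one hr)
  have h2B : 2 ∉ ((2 ^ k - 1).primeFactors ∪ (Finset.Icc 2 (n - k)).biUnion (ppd 2)).erase r := by
    intro h
    rcases Finset.mem_union.1 (Finset.mem_of_mem_erase h) with h | h
    · obtain ⟨l, -, hl⟩ := (mem_primeFactors_two_pow_sub_one hk2).1 h
      exact two_notMem_ppd_two l hl
    · obtain ⟨l, -, hl⟩ := mem_biUnion_ppd_two.1 h
      exact two_notMem_ppd_two l hl
  -- Again 2 replaces `r` in the count.
  rw [gkDegree_projSL2_odd (by omega) r hr (by omega) (S := insert 2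
    (((2 ^ k - 1).primeFactors ∪ (Finset.Icc 2 (n - k)).biUnion (ppd 2)).erase r)),
    Finset.card_insert_of_notMem h2B, Finset.card_erase_add_one hrB]
  intro q
  rw [Finset.mem_insert, Finset.mem_erase, Finset.mem_union,
    mem_primeFactors_two_pow_sub_one hk2, mem_biUnion_ppd_two]
  constructor
  · rintro (rfl | ⟨hne, ⟨l, hl, hq⟩ | ⟨l, hl, hq⟩⟩)
    · exact Or.inl ⟨rfl, hkn⟩
    · have := Nat.le_of_dvd (by omega) hl
      exact Or.inr ⟨hne, l, by omega, hq, Or.inr (Or.inr hl)⟩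
    · exact Or.inr ⟨hne, l, by omega, hq, Or.inl (by omega)⟩
  · rintro (⟨rfl, -⟩ | ⟨hne, l, hl, hq, h⟩)
    · exact Or.inl rfl
    · right
      refine ⟨hne, ?_⟩
      have hl2 := (mem_ppd_two.1 hq).2.2.1
      rcases h with h | ⟨c, rfl⟩ | h
      · exact Or.inr ⟨l, by omega, hq⟩
      · refine Or.inl ⟨_, ?_, hq⟩
        rcases c with _ | _ | c
        · omega
        · simp
        · rw [show k * (c + 1 + 1) = k * c + k + k by ring] at hl
          omega
      · exact Or.inl ⟨l, h, hq⟩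

end Formulas

theorem corollary2p6 (n : ℕ) (hn : 3 ≤ n) :
    -- degree of the vertex 2, and the bound on independent sets containing 2
    (∃ h2 : 2 ∈ primeSet (projSL2 n),
      (gkDegree (projSL2 n) ⟨2, h2⟩ : ℤ) =
        ((primeSet (projSL2 n)).card : ℤ) - ((ppd 2 (n - 1) ∪ ppd 2 n).card : ℤ) - 1 ∧
      2 ≤ gkIndepNumAt (projSL2 n) ⟨2, h2⟩) ∧
    -- every odd vertex is covered by the formulas below
    (∀ r : primeSet (projSL2 n), Odd (r : ℕ) → ∃ k, 2 ≤ k ∧ k ≤ n ∧ (r : ℕ) ∈ ppd 2 k) ∧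
    -- degrees of the odd vertices
    (∀ (r : primeSet (projSL2 n)) (k : ℕ), Odd (r : ℕ) → (r : ℕ) ∈ ppd 2 k →
      ((k = n ∨ k = n - 1) →
        (gkDegree (projSL2 n) r : ℤ) = ((2 ^ k - 1).primeFactors.card : ℤ) - 1) ∧
      ((k ≠ n ∧ k ≠ n - 1) →
        (2 * k ≤ n →
          gkDegree (projSL2 n) r =
            ((Finset.Icc 2 (n - k)).biUnion (ppd 2)).card + (ppd 2 (n / k * k)).card) ∧
        (n < 2 * k →
          gkDegree (projSL2 n) r =
            ((2 ^ k - 1).primeFactors ∪ (Finset.Icc 2 (n - k)).biUnion (ppd 2)).card))) := by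

  have hmem : ∀ r : primeSet (projSL2 n), Odd (r : ℕ) → ∃ k ≤ n, (r : ℕ) ∈ ppd 2 k := by
    intro r hodd
    refine ((mem_primeSet_projSL2 (by omega)).1 r.2).resolve_left fun h => ?_
    rw [h] at hodd
    exact absurd hodd (by decide)
  have h2 : 2 ∈ primeSet (projSL2 n) := (mem_primeSet_projSL2 (by omega)).2 (Or.inl rfl)
  refine ⟨⟨h2, gkDegree_projSL2_two_eq hn h2, two_le_gkIndepNumAt_projSL2_two hn h2⟩, ?_, ?_⟩
  · intro r hodd
    obtain ⟨k, hk, hr⟩ := hmem r hodd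
    exact ⟨k, (mem_ppd_two.1 hr).2.2.1, hk, hr⟩
  · intro r k hodd hr
    obtain ⟨k', hk', hr'⟩ := hmem r hodd
    obtain rfl := ppd_two_index_unique hr hr'
    refine ⟨gkDegree_projSL2_odd_top hn r hr, fun hkn => ⟨fun hk => ?_, fun hk => ?_⟩⟩
    · exact gkDegree_projSL2_odd_low hn r hr hk (by omega)
    · exact gkDegree_projSL2_odd_high hn r hr hk (by omega)
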